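/- **Theorem (Hawking's theorem).** Units are $\hbar=c=G=1$, so every Planck scale is $1$; $\log$ is the natural logarithm. *Setting.* An evaporation process emitting $N$ quanta consists of the following data. (a) A smooth spacetime foliated by spacelike slices diffeomorphic to $\mathbb R^3$ (induced metric $h$, lapse, shift), matter on it (a stress-energy tensor and the phases of its waves), times $t_0<t_1<\dots$, and, for each $n<N$, a surface $\{f_n=0\}$ on the slice $t_n$ and a field mode of wavelength $\lambda_n$ located in a region that meets this surface. (b) A Hilbert space $H$ of matter states. The state on the slice $t_n$ is a vector $\Psi_n\in \mathcal H_n=H\otimes(\mathbb C^2)^{\otimes n}_{l}\otimes(\mathbb C^2)^{\otimes n}_{r}$ ($l_i$ fallen into the hole, $r_i$ emitted), with $\Psi_0\in H$ a unit vector. The mode of step $n$ is in a unit Fock state $\varphi_n=\sum_k\alpha_{n,k}|k\rangle$, and $\Psi_{n+1}=W_n(\Psi_n\otimes\varphi_n)$ with an isometry $W_n:\mathcal H_n\otimes\mathrm{Fock}\to\mathcal H_{n+1}$. *Niceness.* Step $n$ is $\eta$-nice if $\lambda_n>1/\eta$ and on all slices $t\in[t_n,t_{n+1}]$ the following are everywhere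 smaller than $\eta$: the norms of the intrinsic curvature of the slice, of its extrinsic curvature and of the spacetime curvature, the energy and momentum densities and the inverse wavelengths of the matter, and the gradients along the slice of lapse and shift. A process is $\eta$-nice if each step $n<N$ is. *Traditional black hole.* It is traditional with accuracies $\eta,\gamma$ if for each $n<N$ the surface $\{f_n=0\}$ is a horizon on the slice $t_n$ (a nonempty smooth surface with $\{f_n\le0\}$ compact, zero expansion of outgoing and negative expansion of ingoing light) all of whose points are information-free: if the region of the mode of step $n$ contains the point and $\lambda_n>1/\eta$, then $\sum_{k\ge1}|\alpha_{n,k}|^2<\gamma$. *Niceness conditions ensure local semiclassical evolution.* Let $S^{(1)}=\frac1{\sqrt2}(|0\rangle_l|0\rangle_r+|1\rangle_l|1\rangle_r)$. A class $\mathcal C$ of processes with matter space $H$ has this property if for every $\delta>0$ there is $\eta>0$ such that, for each process in $\mathcal C$ and each $\eta$-nice step $n<N$ at whose beginning $\{f_n=0\}$ is a horizon, $W_n$ is local, i.e. $W_n=V\otimes\mathbf 1$ with $\mathbf 1$ the identity on the previously emitted quanta, and agrees up to $\delta$ with the leading-order semiclassical evolution: $\|W_n(\Psi\otimes|0\rangle)-\Psi\otimes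 S^{(1)}\|\le\delta\|\Psi\|$ for all $\Psi\in\mathcal H_n$. *Claim.* Let $0<\varepsilon\le\frac14\log2$. There is $\gamma>0$ such that for every class $\mathcal C$ with this property there is $\eta>0$ such that every $\eta$-nice process in $\mathcal C$ whose black hole is traditional with accuracies $\eta,\gamma$ satisfies, with $S_n$ the von Neumann entropy of the reduced state $\rho_n$ of $r_1,\dots,r_n$ in $\Psi_n$: 1. For $n<N$, the new pair is within $\varepsilon$ of the Bell state: the part of $\Psi_{n+1}$ orthogonal to the states $\Lambda\otimes S^{(1)}$, $\Lambda\in\mathcal H_n$, has norm less than $\varepsilon$. 2. For $n<N$, $S_{n+1}>S_n+\log2-2\varepsilon$. 3. If $N\ge1$, then $S_N>\frac N2\log2$. 4. If $N\ge1$, formation and evaporation end in a mixed state or a remnant: for every finite-dimensional Hilbert space $K$ of whatever is left of the hole ($\dim K=1$ if it has disappeared) and every final density matrix on $K\otimes(\mathbb C^2)^{\otimes N}_r$ with reduced state $\rho_N$ of the emitted quanta, this final state is not pure or $\dim K>2^{N/2}$. In particular, if the hole disappears completely, the final state is mixed. -/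

import Mathlib

open scoped ContDiff InnerProductSpace ComplexOrder
open Matrix

noncomputable section

/-! ## Curvature in a chart (units `ħ = c = G = 1`, so all Planck quantities equal `1`) -/

/-- Partial derivative along the `i`-th coordinate. -/
def pd {d : ℕ} (i : Fin d) (f : (Fin d → ℝ) → ℝ) (x : Fin d → ℝ) : ℝ :=
  fderiv ℝ f x (Pi.single i 1)

/-- Christoffel symbols `Γ^k_{ij}` of a metric `g`. -/
def christoffel {d : ℕ} (g : (Fin d → ℝ) → Matrix (Fin d) (Fin d) ℝ) (k i j : Fin d)
    (x : Fin d → ℝ) : ℝ :=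
  (1 / 2) * ∑ l, (g x)⁻¹ k l *
    (pd i (fun y => g y l j) x + pd j (fun y => g y l i) x - pd l (fun y => g y i j) x)

/-- The curvature tensor `R^k_{lij}` of a metric `g`. -/
def riemannUp {d : ℕ} (g : (Fin d → ℝ) → Matrix (Fin d) (Fin d) ℝ) (k l i j : Fin d)
    (x : Fin d → ℝ) : ℝ :=
  pd i (christoffel g k j l) x - pd j (christoffel g k i l) x +
    ∑ m, (christoffel g k i m x * christoffel g m j l x -
      christoffel g k j m x * christoffel g m i l x)

/-- The covariant curvature tensor `R_{klij}` of a metric `g`. -/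
def riemann {d : ℕ} (g : (Fin d → ℝ) → Matrix (Fin d) (Fin d) ℝ) (k l i j : Fin d)
    (x : Fin d → ℝ) : ℝ :=
  ∑ m, g x k m * riemannUp g m l i j x

/-- The norm of a covariant 1-tensor for the inverse metric `q` (positive definite). -/
def norm1 {d : ℕ} (q : Matrix (Fin d) (Fin d) ℝ) (w : Fin d → ℝ) : ℝ :=
  √(∑ i, ∑ j, q i j * w i * w j)

/-- The norm of a covariant 2-tensor for the inverse metric `q` (positive definite). -/
def norm2 {d : ℕ} (q : Matrix (Fin d) (Fin d) ℝ) (w : Fin d → Fin d → ℝ) : ℝ :=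
  √(∑ i, ∑ j, ∑ i', ∑ j', q i i' * q j j' * w i j * w i' j')

/-- The norm of a covariant 4-tensor for the inverse metric `q` (positive definite). -/
def norm4 {d : ℕ} (q : Matrix (Fin d) (Fin d) ℝ) (w : Fin d → Fin d → Fin d → Fin d → ℝ) : ℝ :=
  √(∑ i, ∑ j, ∑ k, ∑ l, ∑ i', ∑ j', ∑ k', ∑ l',
    q i i' * q j j' * q k k' * q l l' * w i j k l * w i' j' k' l')

/-! ## Spacetimes foliated by spacelike slices -/

/-- A spacetime foliated by spacelike slices diffeomorphic to `ℝ³`, in 3+1 form: coordinate `0` of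
`Fin 4 → ℝ` labels the slices, `h` is the (Riemannian) metric induced on them. -/
structure SlicedSpacetime where
  h : (Fin 4 → ℝ) → Matrix (Fin 3) (Fin 3) ℝ
  lapse : (Fin 4 → ℝ) → ℝ
  shift : (Fin 4 → ℝ) → Fin 3 → ℝ
  h_smooth : ∀ i j, ContDiff ℝ ∞ fun p => h p i j
  lapse_smooth : ContDiff ℝ ∞ lapse
  shift_smooth : ∀ i, ContDiff ℝ ∞ fun p => shift p i
  h_posDef : ∀ p, (h p).PosDef
  lapse_pos : ∀ p, 0 < lapse p

namespace SlicedSpacetime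

variable (S : SlicedSpacetime)

/-- The point of coordinates `x` on the slice `t`. -/
def pt (t : ℝ) (x : Fin 3 → ℝ) : Fin 4 → ℝ := Fin.cons t x

/-- The induced metric of the slice `t`, as a metric on `ℝ³`. -/
def sliceMetric (t : ℝ) (x : Fin 3 → ℝ) : Matrix (Fin 3) (Fin 3) ℝ := S.h (pt t x)

/-- The Lorentzian metric `-N² dt² + h_ij (dx^i + β^i dt) (dx^j + β^j dt)`. -/
def metric (p : Fin 4 → ℝ) : Matrix (Fin 4) (Fin 4) ℝ :=
  Matrix.of (Fin.cons
    (Fin.cons (-(S.lapse p) ^ 2 + ∑ i, ∑ j, S.h p i j * S.shift p i * S.shift p j)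
      (fun j => ∑ k, S.h p j k * S.shift p k))
    (fun i => Fin.cons (∑ k, S.h p i k * S.shift p k) (fun j => S.h p i j)))

/-- The future unit normal `n = N⁻¹ (∂_t - β^i ∂_i)` of the slices. -/
def normal (p : Fin 4 → ℝ) : Fin 4 → ℝ :=
  Fin.cons (1 / S.lapse p) (fun i => -(S.shift p i) / S.lapse p)

/-- The inverse `g^{μν} + 2 n^μ n^ν` of the Euclidean metric in which an orthonormal frame
`(n, e₁, e₂, e₃)` adapted to the slices is orthonormal. -/
def frameInv (p : Fin 4 → ℝ) : Matrix (Fin 4) (Fin 4) ℝ :=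
  (S.metric p)⁻¹ + (2 : ℝ) • Matrix.vecMulVec (S.normal p) (S.normal p)

/-- Extrinsic curvature `K_ij = (∂_t h_ij - (L_β h)_ij) / (2N)`. -/
def extrinsic (p : Fin 4 → ℝ) (i j : Fin 3) : ℝ :=
  (pd 0 (fun q => S.h q i j) p -
    ∑ k : Fin 3, (S.shift p k * pd k.succ (fun q => S.h q i j) p +
      S.h p k j * pd i.succ (fun q => S.shift q k) p +
      S.h p i k * pd j.succ (fun q => S.shift q k) p)) / (2 * S.lapse p)

/-- The covariant derivative `D_i β_j` of the shift along the slice, with lowered index. -/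
def shiftGradient (p : Fin 4 → ℝ) (i j : Fin 3) : ℝ :=
  ∑ k, S.h p j k * (pd i.succ (fun q => S.shift q k) p +
    ∑ l, christoffel (S.sliceMetric (p 0)) k i l (Fin.tail p) * S.shift p l)

/-- The outward unit normal, tangent to the slice `t`, of the level surfaces of `f`. -/
def surfaceNormal (t : ℝ) (f : (Fin 3 → ℝ) → ℝ) (i : Fin 3) (x : Fin 3 → ℝ) : ℝ :=
  (∑ j, (S.sliceMetric t x)⁻¹ i j * pd j f x) /
    norm1 (S.sliceMetric t x)⁻¹ (fun j => pd j f x)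

/-- Expansion of the future null normals `n + σ s` of the level surfaces of `f` on the slice `t`:
outgoing for `σ = 1`, ingoing for `σ = -1`. -/
def nullExpansion (σ t : ℝ) (f : (Fin 3 → ℝ) → ℝ) (x : Fin 3 → ℝ) : ℝ :=
  σ * ∑ i, (pd i (S.surfaceNormal t f i) x +
      ∑ j, christoffel (S.sliceMetric t) j j i x * S.surfaceNormal t f i x) +
    ∑ i, ∑ j, ((S.sliceMetric t x)⁻¹ i j -
      S.surfaceNormal t f i x * S.surfaceNormal t f j x) * S.extrinsic (pt t x) i j

/-- `{f = 0}` is the horizon of a black hole on the slice `t`: a compact smooth surface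
(with inside `{f < 0}`) from which outgoing light does not expand, while ingoing light contracts. -/
structure IsHorizon (t : ℝ) (f : (Fin 3 → ℝ) → ℝ) : Prop where
  smooth : ContDiff ℝ ∞ f
  inside_compact : IsCompact {x | f x ≤ 0}
  nonempty : ∃ x, f x = 0
  regular : ∀ x, f x = 0 → fderiv ℝ f x ≠ 0
  outgoing : ∀ x, f x = 0 → S.nullExpansion 1 t f x = 0
  ingoing : ∀ x, f x = 0 → S.nullExpansion (-1) t f x < 0

end SlicedSpacetime

/-- The matter on the slices: its stress-energy tensor (all indices down) and the phases of the
waves of which it is made. -/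
structure MatterContent where
  T : (Fin 4 → ℝ) → Matrix (Fin 4) (Fin 4) ℝ
  T_symm : ∀ p, (T p).IsSymm
  phases : Set ((Fin 4 → ℝ) → ℝ)
  phases_smooth : ∀ θ ∈ phases, ContDiff ℝ ∞ θ

/-- The slice `t` is nice to accuracy `η`: compared to the Planck scale (which is `1`), the
following are smaller than `η`: its intrinsic and its extrinsic curvature, the curvature of the
spacetime along it, the energy and momentum densities and the inverse wavelengths
(`|dθ| / 2π`) of the matter on it, and the rates of change of lapse and shift along it. -/
structure NiceSlice (S : SlicedSpacetime) (Q : MatterContent) (η t : ℝ) : Prop where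
  intrinsic : ∀ x, norm4 (S.sliceMetric t x)⁻¹
    (fun i j k l => riemann (S.sliceMetric t) i j k l x) < η
  extrinsic : ∀ x, norm2 (S.sliceMetric t x)⁻¹ (S.extrinsic (SlicedSpacetime.pt t x)) < η
  spacetime : ∀ x, norm4 (S.frameInv (SlicedSpacetime.pt t x))
    (fun i j k l => riemann S.metric i j k l (SlicedSpacetime.pt t x)) < η
  energy : ∀ x, |∑ a, ∑ b, Q.T (SlicedSpacetime.pt t x) a b *
    S.normal (SlicedSpacetime.pt t x) a * S.normal (SlicedSpacetime.pt t x) b| < η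
  momentum : ∀ x, norm1 (S.sliceMetric t x)⁻¹ (fun i : Fin 3 =>
    ∑ a, Q.T (SlicedSpacetime.pt t x) a i.succ * S.normal (SlicedSpacetime.pt t x) a) < η
  wavelength : ∀ θ ∈ Q.phases, ∀ x, norm1 (S.sliceMetric t x)⁻¹
    (fun i : Fin 3 => pd i.succ θ (SlicedSpacetime.pt t x)) < 2 * Real.pi * η
  lapse : ∀ x, norm1 (S.sliceMetric t x)⁻¹
    (fun i : Fin 3 => pd i.succ S.lapse (SlicedSpacetime.pt t x)) < η
  shift : ∀ x, norm2 (S.sliceMetric t x)⁻¹ (S.shiftGradient (SlicedSpacetime.pt t x)) < η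

/-! ## Quantum states of hole and radiation -/

section Quantum

variable {H : Type*} [NormedAddCommGroup H] [InnerProductSpace ℂ H]

/-- Computational basis of `n` qubits. -/
abbrev Bits (n : ℕ) := Fin n → Fin 2

/-- `H ⊗ (ℂ²)^{⊗ n} ⊗ (ℂ²)^{⊗ n}`: the matter `M`, the `n` infallen quanta `l₁, …, l_n` and the `n`
emitted quanta `r₁, …, r_n`. The component at `(l, r)` is the amplitude of `|l⟩ ⊗ |r⟩`. -/
abbrev HoleRad (H : Type*) [NormedAddCommGroup H] [InnerProductSpace ℂ H] (n : ℕ) :=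
  PiLp 2 (fun _ : Bits n × Bits n => H)

/-- The Hilbert space `H ⊗ (ℂ²)^{⊗ n}` of the hole: the matter and the infallen quanta. -/
abbrev Hole (H : Type*) [NormedAddCommGroup H] [InnerProductSpace ℂ H] (n : ℕ) :=
  PiLp 2 (fun _ : Bits n => H)

/-- The Fock space of one field mode; `φ k` is the amplitude of the `k`-particle state. -/
abbrev Fock := lp (fun _ : ℕ => ℂ) 2

/-- `HoleRad H n ⊗ Fock`. -/
abbrev WithMode (H : Type*) [NormedAddCommGroup H] [InnerProductSpace ℂ H] (n : ℕ) :=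
  lp (fun _ : ℕ => HoleRad H n) 2

theorem memlp_smul {E : Type*} [NormedAddCommGroup E] [NormedSpace ℂ E] (φ : Fock) (Ψ : E) :
    Memℓp (fun k : ℕ => φ k • Ψ) 2 := by
  have h := lp.memℓp φ
  rw [memℓp_gen_iff (by norm_num)] at h ⊢
  simp only [norm_smul]
  have h2 := h.mul_right (‖Ψ‖ ^ (2 : ENNReal).toReal)
  refine h2.congr fun k => ?_
  rw [Real.mul_rpow (norm_nonneg _) (norm_nonneg _)]

/-- The product state `Ψ ⊗ φ` of hole and radiation with a field mode. -/
def withMode {n : ℕ} (Ψ : HoleRad H n) (φ : Fock) : WithMode H n :=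
  ⟨fun k => φ k • Ψ, memlp_smul φ Ψ⟩

/-- The vacuum state of a mode. -/
def vacuum : Fock := lp.single 2 0 1

/-- The probability `∑_{k ≥ 1} |φ_k|²` to find particles in a mode. -/
def particleWeight (φ : Fock) : ℝ := ∑' k : ℕ, ‖φ (k + 1)‖ ^ 2

/-- `Λ ⊗ S⁽¹⁾`, where `S⁽¹⁾ = (|0⟩_l |0⟩_r + |1⟩_l |1⟩_r) / √2` is the Bell state of the newly created
quanta `(l_{n+1}, r_{n+1})`: the evolution to leading order. -/
def tensorBell {n : ℕ} (Λ : HoleRad H n) : HoleRad H (n + 1) :=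
  WithLp.toLp 2 fun q => if q.1 (Fin.last n) = q.2 (Fin.last n) then
    ((1 / √2 : ℝ) : ℂ) • Λ (Fin.init q.1, Fin.init q.2) else 0

/-- The component `⟨S⁽¹⁾|Ψ⟩` of a state along the Bell state of its last pair. -/
def bellComponent {n : ℕ} (Ψ : HoleRad H (n + 1)) : HoleRad H n :=
  WithLp.toLp 2 fun q => ((1 / √2 : ℝ) : ℂ) •
    ∑ b : Fin 2, Ψ (Fin.snoc (α := fun _ => Fin 2) q.1 b, Fin.snoc (α := fun _ => Fin 2) q.2 b)

/-- The size of the correction to the leading-order state of the last pair: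
the norm of the part of the state orthogonal to `S⁽¹⁾`. -/
def pairCorrection {n : ℕ} (Ψ : HoleRad H (n + 1)) : ℝ :=
  ‖Ψ - tensorBell (bellComponent Ψ)‖

/-- The evolution through one step, which creates one pair, is local: it has the form
`V ⊗ 1` where `1` is the identity of the quanta emitted before, and `V` turns hole and mode into hole
and new pair. `V k ψ b c` is the amplitude of `|b⟩_{l_{n+1}} |c⟩_{r_{n+1}}` in `V (ψ ⊗ |k⟩)`. -/
def IsLocal {n : ℕ} (W : WithMode H n →ₗᵢ[ℂ] HoleRad H (n + 1)) : Prop :=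
  ∃ V : ℕ → Hole H n → Fin 2 → Fin 2 → Hole H n, ∀ (k : ℕ) (Ψ : HoleRad H n)
    (l r : Bits n) (b c : Fin 2),
    W (lp.single 2 k Ψ)
        (Fin.snoc (α := fun _ => Fin 2) l b, Fin.snoc (α := fun _ => Fin 2) r c) =
      V k (WithLp.toLp 2 fun l' => Ψ (l', r)) b c l

/-- The evolution agrees to accuracy `δ` with the leading-order semiclassical one, in which a mode
in its vacuum state is stretched into a pair in the Bell state and nothing else changes. -/
def IsSemiclassical (δ : ℝ) {n : ℕ} (W : WithMode H n →ₗᵢ[ℂ] HoleRad H (n + 1)) : Prop :=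
  ∀ Ψ : HoleRad H n, ‖W (withMode Ψ vacuum) - tensorBell Ψ‖ ≤ δ * ‖Ψ‖

/-- The reduced density matrix of the emitted quanta. -/
def radiationDensity {n : ℕ} (Ψ : HoleRad H n) : Matrix (Bits n) (Bits n) ℂ :=
  Matrix.of fun a b => ∑ l : Bits n, ⟪Ψ (l, b), Ψ (l, a)⟫_ℂ

theorem radiationDensity_isHermitian {n : ℕ} (Ψ : HoleRad H n) :
    (radiationDensity Ψ).IsHermitian := by
  ext a b
  simp [radiationDensity, Matrix.conjTranspose_apply]

/-- The entanglement entropy `-tr (ρ log ρ)` of the emitted quanta with the hole. -/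
def radiationEntropy {n : ℕ} (Ψ : HoleRad H n) : ℝ :=
  ∑ i, Real.negMulLog ((radiationDensity_isHermitian Ψ).eigenvalues i)

end Quantum

/-- The state with density matrix `σ` is pure, i.e. described by a single ket. -/
def IsPureState {ι : Type*} (σ : Matrix ι ι ℂ) : Prop :=
  ∃ χ : ι → ℂ, σ = Matrix.vecMulVec χ (star χ)

/-- Emission of `N` quanta in the state `ρ` leads to mixed states/remnants: let `κ` index a basis of
what is left of the hole in the end (one element if it has disappeared), and `σ` be any final state
in which the emitted quanta are still in the state `ρ`. Then `σ` is mixed, or the hole has left a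
remnant with more than `2^{N/2}` independent states. -/
def LeadsToMixedStateOrRemnant {N : ℕ} (ρ : Matrix (Bits N) (Bits N) ℂ) : Prop :=
  ∀ (κ : Type) [Fintype κ] (σ : Matrix (κ × Bits N) (κ × Bits N) ℂ),
    σ.PosSemidef → (∀ a b, ∑ m, σ (m, a) (m, b) = ρ a b) →
      ¬ IsPureState σ ∨ (2 : ℝ) ^ ((N : ℝ) / 2) < Fintype.card κ

/-! ## Formation and evaporation of a black hole -/

/-- A process in which a black hole made of matter with Hilbert space `H` emits `N` quanta.
Step `n` (for `n < N`) leads from the slice `time n` to the slice `time (n + 1)`. In it a field mode,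
located around the horizon `{horizon n = 0}`, is turned into the pair `(l_{n+1}, r_{n+1})`. -/
structure Evaporation (H : Type*) [NormedAddCommGroup H] [InnerProductSpace ℂ H] where
  N : ℕ
  spacetime : SlicedSpacetime
  content : MatterContent
  time : ℕ → ℝ
  time_mono : StrictMono time
  horizon : ℕ → (Fin 3 → ℝ) → ℝ
  /-- where the mode is located on the slice `time n` -/
  support : ℕ → Set (Fin 3 → ℝ)
  support_horizon : ∀ n < N, ∃ x ∈ support n, horizon n x = 0
  wavelength : ℕ → ℝ
  wavelength_pos : ∀ n, 0 < wavelength n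
  /-- the state of the mode before it is turned into a pair -/
  mode : ℕ → Fock
  mode_norm : ∀ n, ‖mode n‖ = 1
  /-- the state of the matter that forms the hole -/
  matter : H
  matter_norm : ‖matter‖ = 1
  evolution : ∀ n, WithMode H n →ₗᵢ[ℂ] HoleRad H (n + 1)

namespace Evaporation

variable {H : Type*} [NormedAddCommGroup H] [InnerProductSpace ℂ H] (P : Evaporation H)

/-- The state of hole and radiation on the slice `time n`. -/
def state : ∀ n, HoleRad H n
  | 0 => WithLp.toLp 2 fun _ => P.matter
  | n + 1 => P.evolution n (withMode (state n) (P.mode n))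

/-- The niceness conditions hold to accuracy `η` throughout the step `n`. -/
def NiceStep (η : ℝ) (n : ℕ) : Prop :=
  (∀ t ∈ Set.Icc (P.time n) (P.time (n + 1)), NiceSlice P.spacetime P.content η t) ∧
    1 < η * P.wavelength n

/-- The niceness conditions hold to accuracy `η` for as long as quanta are emitted. -/
def Nice (η : ℝ) : Prop := ∀ n < P.N, P.NiceStep η n

/-- A point of the horizon at step `n` is information-free (to accuracy `γ`): field modes around it
whose wavelength exceeds the Planck length by the factor `1/η` are free of particles. -/
def InformationFreeAt (η γ : ℝ) (n : ℕ) (x : Fin 3 → ℝ) : Prop :=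
  x ∈ P.support n → 1 < η * P.wavelength n → particleWeight (P.mode n) < γ

/-- The black hole is traditional: it has a horizon, and all points of it are information-free. -/
def IsTraditional (η γ : ℝ) : Prop :=
  ∀ n < P.N, P.spacetime.IsHorizon (P.time n) (P.horizon n) ∧
    ∀ x, P.horizon n x = 0 → P.InformationFreeAt η γ n x

end Evaporation

/-- In the class `C` of physically possible processes, the niceness conditions ensure local
semiclassical evolution: in the limit in which they hold ever better, the formation of pairs
at a horizon is local and is given by the leading-order semiclassical evolution to any accuracy. -/
def NicenessEnsuresLocalEvolution {H : Type*} [NormedAddCommGroup H] [InnerProductSpace ℂ H]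
    (C : Set (Evaporation H)) : Prop :=
  ∀ δ > 0, ∃ η > 0, ∀ P ∈ C, ∀ n < P.N, P.NiceStep η n →
    P.spacetime.IsHorizon (P.time n) (P.horizon n) →
      IsLocal (P.evolution n) ∧ IsSemiclassical δ (P.evolution n)

end

/-!
In each step the mode at the horizon is nearly empty, so by semiclassical evolution the new state
is within a small `μ` of a multiple of `Ψ ⊗ S⁽¹⁾` (`norm_evolution_sub_lt`). The correction to the
pair is the distance to the closest state of the form `Λ ⊗ S⁽¹⁾`, hence smaller than `μ`
(`pairCorrection_le`).

For the entropy, the point is that `μ` must not depend on the number of quanta already emitted, so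
a continuity bound for the von Neumann entropy of the whole radiation is of no use. Locality
provides more: the reduced state `A` of the earlier quanta is exactly unchanged
(`IsLocal.marginal`). Thus the new reduced state `ρ` has the marginal `A`, and it is close to
`σ = A ⊗ 1/2`, whose entropy is `S(A) + log 2`. For such a pair of states the difference of the
entropies is bounded independently of the dimension (`Matrix.entropy_add_log_two_le`). This takes
the place of strong subadditivity, and uses only operator monotonicity of the logarithm, Klein's
inequality, and `ρ ≤ 2 A ⊗ 1 = 4 σ`, which holds for every state with the marginal `A`
(`Matrix.le_two_smul_kroneckerOne`). Closeness enters through `ρ ≤ (1 + t) σ + E` with `t` and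
`tr E` small (`radiationDensity_add_le`).

Summing up, `S_N > N (log 2 - 2 ε) ≥ (N / 2) log 2`. If the final state on remnant and radiation
is pure, the reduced state of the radiation has rank at most the dimension of the remnant, and its
entropy is at most the logarithm of the rank (`Matrix.reTrace_negMulLog_le_log_of_rank_le`).
-/

namespace Matrix

open scoped MatrixOrder Matrix.Norms.L2Operator Kronecker

/-! ### Traces of functions of Hermitian matrices -/

variable {ι R B : Type*} [Fintype ι]

/-- The real part of the trace, as a real-linear functional. -/
noncomputable def reTrace : Matrix ι ι ℂ →ₗ[ℝ] ℝ :=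
  Complex.reLm ∘ₗ (traceLinearMap ι ℝ ℂ)

theorem reTrace_apply (A : Matrix ι ι ℂ) : reTrace A = A.trace.re := rfl

variable [DecidableEq ι] [Fintype R] [DecidableEq R] [Fintype B] [DecidableEq B]

theorem reTrace_mul_nonneg {A B : Matrix ι ι ℂ} (hA : 0 ≤ A) (hB : 0 ≤ B) :
    0 ≤ reTrace (A * B) := by
  obtain ⟨X, rfl⟩ := CStarAlgebra.nonneg_iff_eq_star_mul_self.mp hA
  rw [reTrace_apply, mul_assoc, trace_mul_comm]
  have h := (hB.posSemidef.mul_mul_conjTranspose_same X).trace_nonneg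
  exact (Complex.le_def.mp h).1

theorem reTrace_mul_le_mul {A B C : Matrix ι ι ℂ} (hA : 0 ≤ A) (h : B ≤ C) :
    reTrace (A * B) ≤ reTrace (A * C) := by
  have := reTrace_mul_nonneg hA (sub_nonneg.mpr h)
  rwa [mul_sub, map_sub, sub_nonneg] at this

theorem reTrace_mul_le_mul_right {A B C : Matrix ι ι ℂ} (hA : 0 ≤ A) (h : B ≤ C) :
    reTrace (B * A) ≤ reTrace (C * A) := by
  have := reTrace_mul_nonneg (sub_nonneg.mpr h) hA
  rwa [sub_mul, map_sub, sub_nonneg] at this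

theorem continuousOn_real_spectrum (f : ℝ → ℝ) (A : Matrix ι ι ℂ) :
    ContinuousOn f (spectrum ℝ A) :=
  (finite_real_spectrum).continuousOn f

theorem reTrace_cfc {A : Matrix ι ι ℂ} (hA : A.IsHermitian) (f : ℝ → ℝ) :
    reTrace (cfc f A) = ∑ i, f (hA.eigenvalues i) := by
  rw [reTrace_apply, hA.cfc_eq, IsHermitian.cfc, Unitary.conjStarAlgAut_apply, trace_mul_comm,
    ← mul_assoc]
  simp [trace_diagonal]

/-- Traces of products of functions of two Hermitian matrices are averages over pairs of
eigenvalues; the weight of a pair is the squared overlap of the eigenvectors. -/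
theorem exists_reTrace_cfc_mul_cfc {A B : Matrix ι ι ℂ} (hA : A.IsHermitian)
    (hB : B.IsHermitian) :
    ∃ w : ι → ι → ℝ, (∀ i j, 0 ≤ w i j) ∧ ∀ f g : ℝ → ℝ,
      reTrace (cfc f A * cfc g B) =
        ∑ i, ∑ j, w i j * (f (hA.eigenvalues i) * g (hB.eigenvalues j)) := by
  set U := (hA.eigenvectorUnitary : Matrix ι ι ℂ) with hU
  set V := (hB.eigenvectorUnitary : Matrix ι ι ℂ) with hV
  refine ⟨fun i j => Complex.normSq ((star U * V) i j), fun i j => Complex.normSq_nonneg _,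
    fun f g => ?_⟩
  rw [hA.cfc_eq, hB.cfc_eq, IsHermitian.cfc, IsHermitian.cfc, Unitary.conjStarAlgAut_apply,
    Unitary.conjStarAlgAut_apply, ← hU, ← hV]
  set D : Matrix ι ι ℂ := diagonal (RCLike.ofReal ∘ f ∘ hA.eigenvalues) with hD
  set E : Matrix ι ι ℂ := diagonal (RCLike.ofReal ∘ g ∘ hB.eigenvalues) with hE
  have h : (U * D * star U * (V * E * star V)).trace =
      (D * (star U * V) * E * star (star U * V)).trace := by
    rw [mul_assoc, mul_assoc, trace_mul_comm]
    simp only [star_mul, star_star, mul_assoc]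
  rw [reTrace_apply]
  erw [h]
  rw [trace, Complex.re_sum]
  refine Finset.sum_congr rfl fun i _ => ?_
  rw [diag_apply, mul_apply, Complex.re_sum]
  refine Finset.sum_congr rfl fun j _ => ?_
  rw [hE, mul_diagonal, hD, diagonal_mul, star_apply]
  beta_reduce
  generalize (star U * V) i j = z
  simp [Complex.normSq_apply]
  ring

/-- Klein's inequality, as a bound on the entropy of `A`. The scalar inequality behind it is
`log x ≤ x - 1` at `x = t / a`, for an eigenvalue `a` of `A` and an eigenvalue `t` of `T`. -/
theorem klein {A T : Matrix ι ι ℂ} (hA : 0 ≤ A) (hT : IsStrictlyPositive T) :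
    reTrace (cfc Real.negMulLog A) + reTrace A - reTrace T ≤ -reTrace (A * CFC.log T) := by
  have hAh := hA.posSemidef.isHermitian
  have hTh := hT.posDef.isHermitian
  obtain ⟨w, hw, h⟩ := exists_reTrace_cfc_mul_cfc hAh hTh
  have e1 : reTrace (cfc Real.negMulLog A) =
      ∑ i, ∑ j, w i j * Real.negMulLog (hAh.eigenvalues i) := by
    simpa [cfc_const_one ℝ T] using h Real.negMulLog (fun _ => 1)
  have e2 : reTrace A = ∑ i, ∑ j, w i j * hAh.eigenvalues i := by
    simpa [cfc_const_one ℝ T, cfc_id' ℝ A] using h (fun x => x) (fun _ => 1)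
  have e3 : reTrace T = ∑ i, ∑ j, w i j * hTh.eigenvalues j := by
    simpa [cfc_const_one ℝ A, cfc_id' ℝ T] using h (fun _ => 1) (fun x => x)
  have e4 : reTrace (A * CFC.log T) =
      ∑ i, ∑ j, w i j * (hAh.eigenvalues i * Real.log (hTh.eigenvalues j)) := by
    simpa [cfc_id' ℝ A, CFC.log] using h (fun x => x) Real.log
  rw [e1, e2, e3, e4, ← Finset.sum_add_distrib, ← Finset.sum_sub_distrib, ← Finset.sum_neg_distrib]
  refine Finset.sum_le_sum fun i _ => ?_
  rw [← Finset.sum_add_distrib, ← Finset.sum_sub_distrib, ← Finset.sum_neg_distrib]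
  refine Finset.sum_le_sum fun j _ => ?_
  have ha : 0 ≤ hAh.eigenvalues i := hA.posSemidef.eigenvalues_nonneg i
  have ht : 0 < hTh.eigenvalues j := hT.posDef.eigenvalues_pos j
  generalize hAh.eigenvalues i = a at *
  generalize hTh.eigenvalues j = t at *
  have key : Real.negMulLog a + a - t ≤ -(a * Real.log t) := by
    rcases ha.eq_or_lt with rfl | ha
    · simp [ht.le]
    · have := Real.log_le_sub_one_of_pos (div_pos ht ha)
      rw [Real.log_div ht.ne' ha.ne'] at this
      have := mul_le_mul_of_nonneg_left this ha.le
      rw [mul_sub, mul_sub, mul_div_cancel₀ _ ha.ne'] at this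
      rw [Real.negMulLog]
      linarith
  have := mul_le_mul_of_nonneg_left key (hw i j)
  linarith

/-! ### Logarithms of shifted matrices -/

theorem isStrictlyPositive_add_algebraMap {A : Matrix ι ι ℂ} (hA : 0 ≤ A) {κ : ℝ} (hκ : 0 < κ) :
    IsStrictlyPositive (A + algebraMap ℝ _ κ) :=
  (isStrictlyPositive_algebraMap hκ).nonneg_add hA

theorem log_add_algebraMap {A : Matrix ι ι ℂ} (hA : 0 ≤ A) (κ : ℝ) :
    CFC.log (A + algebraMap ℝ _ κ) = cfc (fun x => Real.log (x + κ)) A := by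
  have h : A + algebraMap ℝ _ κ = cfc (fun x => x + κ) A := by
    rw [cfc_add_const κ (fun x => x) A, cfc_id' ℝ A]
  rw [CFC.log, h, ← cfc_comp' Real.log (fun x => x + κ) A
    (((finite_real_spectrum).image _).continuousOn _)]

/-- A positive shift inside the logarithm can only decrease `-tr A log A`. -/
theorem neg_reTrace_mul_log_add_le {A : Matrix ι ι ℂ} (hA : 0 ≤ A) {κ : ℝ} (hκ : 0 < κ) :
    -reTrace (A * CFC.log (A + algebraMap ℝ _ κ)) ≤ reTrace (cfc Real.negMulLog A) := by
  have hAh := hA.posSemidef.isHermitian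
  have h : A * CFC.log (A + algebraMap ℝ _ κ) = cfc (fun x => x * Real.log (x + κ)) A := by
    rw [log_add_algebraMap hA, cfc_mul (fun x => x) (fun x => Real.log (x + κ)) A
      (continuousOn_real_spectrum _ A) (continuousOn_real_spectrum _ A), cfc_id' ℝ A]
  rw [h, reTrace_cfc hAh, reTrace_cfc hAh, ← Finset.sum_neg_distrib]
  refine Finset.sum_le_sum fun i _ => ?_
  have ha : 0 ≤ hAh.eigenvalues i := hA.posSemidef.eigenvalues_nonneg i
  generalize hAh.eigenvalues i = a at *
  rw [Real.negMulLog]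
  rcases ha.eq_or_lt with rfl | ha
  · simp
  · have := mul_le_mul_of_nonneg_left (Real.log_le_log ha (by linarith : a ≤ a + κ)) ha.le
    linarith

theorem smul_le_smul_real {A B : Matrix ι ι ℂ} (h : A ≤ B) {c : ℝ} (hc : 0 ≤ c) :
    c • A ≤ c • B := smul_le_smul_of_nonneg_left h hc

/-- Operator monotonicity of the logarithm, for two shifted matrices that are comparable up to
a factor `c ≥ 1`. -/
theorem log_le_add_log {A T : Matrix ι ι ℂ} (hA : 0 ≤ A) (hT : 0 ≤ T) {κ c : ℝ} (hκ : 0 < κ)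
    (hc : 1 ≤ c) (h : A ≤ c • T) :
    CFC.log (A + algebraMap ℝ _ κ) ≤
      algebraMap ℝ _ (Real.log c) + CFC.log (T + algebraMap ℝ _ κ) := by
  rw [← CFC.log_smul' _ (by linarith) (isStrictlyPositive_add_algebraMap hT hκ)]
  refine CFC.log_le_log ?_ (isStrictlyPositive_add_algebraMap hA hκ)
  rw [smul_add]
  refine add_le_add h ?_
  rw [Algebra.algebraMap_eq_smul_one, smul_smul]
  exact smul_le_smul_of_nonneg_right (by nlinarith) zero_le_one

/-! ### Tensoring with the identity -/

/-- The embedding `A ↦ A ⊗ 1`, as a real star algebra homomorphism, so that it commutes with the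
functional calculus. -/
noncomputable def kroneckerOne (R B : Type*) [Fintype R] [DecidableEq R] [Fintype B]
    [DecidableEq B] :
    Matrix R R ℂ →⋆ₐ[ℝ] Matrix (R × B) (R × B) ℂ where
  toFun A := A ⊗ₖ (1 : Matrix B B ℂ)
  map_one' := one_kronecker_one
  map_mul' A A' := by rw [← mul_kronecker_mul, one_mul]
  map_zero' := zero_kronecker _
  map_add' A A' := add_kronecker _ _ _
  commutes' r := by
    rw [Algebra.algebraMap_eq_smul_one, Algebra.algebraMap_eq_smul_one, smul_kronecker,
      one_kronecker_one]
  map_star' A := by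
    simp [star_eq_conjTranspose, conjTranspose_kronecker]

theorem kroneckerOne_apply (A : Matrix R R ℂ) (a b : R × B) :
    kroneckerOne R B A a b = if a.2 = b.2 then A a.1 b.1 else 0 := by
  change (A ⊗ₖ (1 : Matrix B B ℂ)) a b = _
  rw [kronecker_apply, one_apply]
  simp

theorem kroneckerOne_nonneg {A : Matrix R R ℂ} (hA : 0 ≤ A) : 0 ≤ kroneckerOne R B A :=
  map_nonneg (kroneckerOne R B) hA

theorem cfc_kroneckerOne {A : Matrix R R ℂ} (hA : A.IsHermitian) (f : ℝ → ℝ) :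
    cfc f (kroneckerOne R B A) = kroneckerOne R B (cfc f A) := by
  refine (StarAlgHomClass.map_cfc (S := ℝ) (kroneckerOne R B) f A
    (continuousOn_real_spectrum f A) ?_ hA.isSelfAdjoint ?_).symm
  · exact LinearMap.continuous_of_finiteDimensional
      (kroneckerOne R B).toAlgHom.toLinearMap
  · exact hA.isSelfAdjoint.map (kroneckerOne R B)

/-- Observables of the first factor only see the marginal of a state. -/
theorem trace_mul_kroneckerOne {ρ : Matrix (R × B) (R × B) ℂ} {A : Matrix R R ℂ}
    (h : ∀ a b, ∑ c, ρ (a, c) (b, c) = A a b) (X : Matrix R R ℂ) :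
    (ρ * kroneckerOne R B X).trace = (A * X).trace := by
  simp only [trace, diag_apply, mul_apply, kroneckerOne_apply, Fintype.sum_prod_type, mul_ite,
    mul_zero, Finset.sum_ite_eq', Finset.mem_univ, if_true, ← h, Finset.sum_mul]
  refine Finset.sum_congr rfl fun a _ => ?_
  rw [Finset.sum_comm]

/-- A maximally mixed qubit, uncorrelated with the rest, adds `log 2` to the entropy. -/
theorem reTrace_negMulLog_kroneckerOne_half {A : Matrix R R ℂ} (hA : A.IsHermitian)
    (htr : reTrace A = 1) :
    reTrace (cfc Real.negMulLog (kroneckerOne R (Fin 2) ((1 / 2 : ℝ) • A))) =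
      reTrace (cfc Real.negMulLog A) + Real.log 2 := by
  have hA' : ((1 / 2 : ℝ) • A).IsHermitian := by
    exact (IsSelfAdjoint.smul (IsSelfAdjoint.all (1/2 : ℝ)) hA.isSelfAdjoint)
  rw [cfc_kroneckerOne hA']
  have htr2 : ∀ X : Matrix R R ℂ, reTrace (kroneckerOne R (Fin 2) X) = 2 * reTrace X := by
    intro X
    have : (kroneckerOne R (Fin 2) X).trace = X.trace * 2 := by
      have := trace_kronecker X (1 : Matrix (Fin 2) (Fin 2) ℂ)
      rwa [trace_one, Fintype.card_fin] at this
    rw [reTrace_apply, this, reTrace_apply]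
    simp [mul_comm]
  rw [htr2, ← cfc_comp_smul (1 / 2 : ℝ) Real.negMulLog A
    (((finite_real_spectrum).image _).continuousOn _) hA.isSelfAdjoint, reTrace_cfc hA,
    reTrace_cfc hA]
  have h1 : ∑ i, hA.eigenvalues i = 1 := by
    rw [← htr, ← reTrace_cfc hA (fun x => x), cfc_id' ℝ A hA.isSelfAdjoint]
  have h2 : Real.log 2 = ∑ i, hA.eigenvalues i * Real.log 2 := by
    rw [← Finset.sum_mul, h1, one_mul]
  rw [Finset.mul_sum]
  conv_rhs => rw [h2, ← Finset.sum_add_distrib]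
  refine Finset.sum_congr rfl fun i _ => ?_
  rw [smul_eq_mul, Real.negMulLog_mul, Real.negMulLog, Real.negMulLog, one_div, Real.log_inv]
  ring

/-! ### Entropy of a state close to a product with a maximally mixed qubit -/

/-- Let `σ = A ⊗ 1/2`, and let `ρ` be a state with the marginal `A` that is close to `σ`. Then the
entropy of `ρ` is at least that of `σ`, up to an error independent of the dimension of `A`.

Put `τ = s ρ + (1 - s) σ`. As `ρ ≤ τ / s`, operator monotonicity of the logarithm gives `S(ρ) ≥
-tr ρ log τ - log (1 / s)`. Klein's inequality bounds `-tr σ log τ` by `S(σ)` from below, and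
what remains is `tr (ρ - σ) log τ = tr (ρ - σ) (log τ - log σ)`, since `log σ` acts on the
first factor only. The last difference of logarithms is bounded by `c = log (1 / (1 - s))` on
both sides, because `(1 - s) σ ≤ τ ≤ 4 σ`. -/
theorem entropy_add_log_two_le {ρ E : Matrix (R × Fin 2) (R × Fin 2) ℂ} {A : Matrix R R ℂ}
    {t e s : ℝ} (hρ : 0 ≤ ρ) (hA : 0 ≤ A) (htr : reTrace A = 1)
    (hmarg : ∀ a b, ∑ c, ρ (a, c) (b, c) = A a b)
    (h4 : ρ ≤ (4 : ℝ) • kroneckerOne R (Fin 2) ((1 / 2 : ℝ) • A))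
    (hE : 0 ≤ E) (htrE : reTrace E ≤ e) (ht : 0 ≤ t)
    (hρE : ρ ≤ (1 + t) • kroneckerOne R (Fin 2) ((1 / 2 : ℝ) • A) + E)
    (hs : 3 / 4 ≤ s) (hs1 : s < 1) :
    reTrace (cfc Real.negMulLog A) + Real.log 2 - 2 * Real.log (1 - s)⁻¹ * (t + e)
      - Real.log s⁻¹ ≤ reTrace (cfc Real.negMulLog ρ) := by
  have hA2 : 0 ≤ (1 / 2 : ℝ) • A := smul_nonneg (by norm_num) hA
  set σ := kroneckerOne R (Fin 2) ((1 / 2 : ℝ) • A) with hσdef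
  have hσ : 0 ≤ σ := kroneckerOne_nonneg hA2
  have hmargσ : ∀ a b, ∑ c, σ (a, c) (b, c) = A a b := by
    intro a b
    simp [hσdef, kroneckerOne_apply]
  have hmarg1 : ∀ M : Matrix (R × Fin 2) (R × Fin 2) ℂ, (∀ a b, ∑ c, M (a, c) (b, c) = A a b) →
      ∀ X, reTrace (M * kroneckerOne R (Fin 2) X) = reTrace (A * X) := by
    intro M hM X
    rw [reTrace_apply, trace_mul_kroneckerOne hM, reTrace_apply]
  have hρ1 : reTrace ρ = 1 := by simpa [htr] using hmarg1 ρ hmarg 1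
  have hσ1 : reTrace σ = 1 := by simpa [htr] using hmarg1 σ hmargσ 1
  have hs0 : 0 < s := by linarith
  have hs1' : 0 < 1 - s := by linarith
  set τ := s • ρ + (1 - s) • σ with hτdef
  have hτ : 0 ≤ τ := add_nonneg (smul_nonneg hs0.le hρ) (smul_nonneg hs1'.le hσ)
  have hτ1 : reTrace τ = 1 := by simp [hτdef, hρ1, hσ1]
  have c1 : ρ ≤ s⁻¹ • τ := by
    rw [hτdef, smul_add, smul_smul, inv_mul_cancel₀ hs0.ne', one_smul]
    exact le_add_of_nonneg_right (smul_nonneg (by positivity) (smul_nonneg hs1'.le hσ))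
  have c2 : τ ≤ (1 - s)⁻¹ • σ := by
    have h1 : τ ≤ (4 : ℝ) • σ := by
      calc τ ≤ s • (4 : ℝ) • σ + (1 - s) • (4 : ℝ) • σ := by
            refine add_le_add (smul_le_smul_real h4 hs0.le) (smul_le_smul_real ?_ hs1'.le)
            calc σ = (1 : ℝ) • σ := (one_smul _ _).symm
              _ ≤ (4 : ℝ) • σ := smul_le_smul_of_nonneg_right (by norm_num) hσ
        _ = (4 : ℝ) • σ := by rw [← add_smul]; simp
    refine h1.trans (smul_le_smul_of_nonneg_right ?_ hσ)
    rw [le_inv_comm₀ (by norm_num) hs1']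
    linarith
  have c3 : σ ≤ (1 - s)⁻¹ • τ := by
    rw [hτdef, smul_add, smul_smul _ _ σ, inv_mul_cancel₀ hs1'.ne', one_smul]
    exact le_add_of_nonneg_left (smul_nonneg (by positivity) (smul_nonneg hs0.le hρ))
  set c := Real.log (1 - s)⁻¹ with hc
  have hc1 : 1 ≤ (1 - s)⁻¹ := (one_le_inv₀ hs1').mpr (by linarith)
  have hc0 : 0 ≤ c := Real.log_nonneg hc1
  set d : ℝ := reTrace (1 : Matrix (R × Fin 2) (R × Fin 2) ℂ) with hd
  have hd0 : 0 ≤ d := by simp [hd, reTrace_apply]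
  rw [← reTrace_negMulLog_kroneckerOne_half hA.posSemidef.isHermitian htr, ← hσdef]
  -- `σ` and `τ` may be singular, so the logarithms are taken after a shift by `κ`, which is sent to
  -- `0` at the end
  have main : ∀ κ > 0, reTrace (cfc Real.negMulLog σ) - 2 * c * (t + e) - Real.log s⁻¹
      ≤ reTrace (cfc Real.negMulLog ρ) + d * κ := by
    intro κ hκ
    set Lτ := CFC.log (τ + algebraMap ℝ _ κ) with hLτ
    set Lσ := CFC.log (σ + algebraMap ℝ _ κ) with hLσ
    have alg : ∀ (M : Matrix (R × Fin 2) (R × Fin 2) ℂ) (r : ℝ),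
        reTrace (M * algebraMap ℝ _ r) = r * reTrace M := by
      intro M r
      rw [Algebra.algebraMap_eq_smul_one, mul_smul_comm, mul_one, map_smul, smul_eq_mul]
    have h1 := neg_reTrace_mul_log_add_le hρ hκ
    have h2 := reTrace_mul_le_mul hρ (log_le_add_log hρ hτ hκ
      ((one_le_inv₀ hs0).mpr hs1.le) c1)
    rw [← hLτ, mul_add, map_add, alg, hρ1] at h2
    have h3 := klein hσ (isStrictlyPositive_add_algebraMap hτ hκ)
    have halg1 : reTrace (algebraMap ℝ (Matrix (R × Fin 2) (R × Fin 2) ℂ) κ) = κ * d := by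
      simpa using alg 1 κ
    rw [← hLτ, map_add, hσ1, hτ1, halg1] at h3
    -- the logarithm of `σ + κ` acts on the first factor only, where the marginals agree
    have h4 : reTrace (ρ * Lσ) = reTrace (σ * Lσ) := by
      have : Lσ = kroneckerOne R (Fin 2) (cfc (fun x => Real.log (x + κ)) ((1 / 2 : ℝ) • A)) := by
        rw [hLσ, log_add_algebraMap hσ, hσdef, cfc_kroneckerOne hA2.posSemidef.isHermitian]
      rw [this, hmarg1 ρ hmarg, hmarg1 σ hmargσ]
    have u1 : Lτ ≤ algebraMap ℝ _ c + Lσ := log_le_add_log hτ hσ hκ hc1 c2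
    have u2 : Lσ ≤ algebraMap ℝ _ c + Lτ := log_le_add_log hσ hτ hκ hc1 c3
    -- shifting the difference of the logarithms by `c` makes it positive, and costs nothing since
    -- `ρ` and `σ` have the same trace
    set G := Lτ - Lσ + algebraMap ℝ _ c with hG
    have hG0 : 0 ≤ G := by
      have := sub_nonneg.mpr u2
      rw [hG]; convert this using 1; abel
    have hG2 : G ≤ algebraMap ℝ _ (2 * c) := by
      rw [two_mul, map_add, hG]
      exact add_le_add_left (sub_le_iff_le_add.mpr u1) _
    have h5 : reTrace (ρ * G) ≤ (1 + t) * reTrace (σ * G) + reTrace (E * G) := by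
      have := reTrace_mul_le_mul_right hG0 hρE
      rwa [add_mul, map_add, smul_mul_assoc, map_smul, smul_eq_mul] at this
    have h6 := reTrace_mul_le_mul hσ hG2
    have h7 := reTrace_mul_le_mul hE hG2
    rw [alg, hσ1] at h6
    rw [alg] at h7
    have h8 : reTrace (ρ * G) - reTrace (σ * G) = reTrace (ρ * Lτ) - reTrace (σ * Lτ) := by
      simp only [hG, mul_add, mul_sub, map_add, map_sub, alg, hρ1, hσ1, h4]
      ring
    have h9 : t * reTrace (σ * G) ≤ t * (2 * c * 1) := mul_le_mul_of_nonneg_left h6 ht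
    have h10 : 2 * c * reTrace E ≤ 2 * c * e := mul_le_mul_of_nonneg_left htrE (by positivity)
    linarith
  refine le_of_forall_pos_le_add fun ε hε => ?_
  refine (main (ε / (d + 1)) (by positivity)).trans ?_
  have : d * (ε / (d + 1)) ≤ ε := by
    rw [← mul_div_assoc, div_le_iff₀ (by positivity)]
    nlinarith
  linarith

/-! ### Relabelling, rank, and the bound by the marginal -/

variable {κ : Type*} [Fintype κ] [DecidableEq κ]

theorem reTrace_cfc_submatrix {A : Matrix ι ι ℂ} (hA : A.IsHermitian) (e : κ ≃ ι) (f : ℝ → ℝ) :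
    reTrace (cfc f (A.submatrix e e)) = reTrace (cfc f A) := by
  let φ : Matrix ι ι ℂ →⋆ₐ[ℝ] Matrix κ κ ℂ :=
    { (reindexAlgEquiv ℝ ℂ e.symm).toAlgHom with
      map_star' := fun M => rfl }
  have hφ : ∀ M, φ M = M.submatrix e e := fun M => rfl
  have h := StarAlgHomClass.map_cfc (S := ℝ) φ f A (continuousOn_real_spectrum f A)
    (LinearMap.continuous_of_finiteDimensional φ.toAlgHom.toLinearMap) hA.isSelfAdjoint
    (hA.isSelfAdjoint.map φ)
  rw [hφ, hφ] at h
  rw [← h, reTrace_apply, reTrace_apply]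
  congr 1
  exact Equiv.sum_comp e fun i => cfc f A i i

/-- The entropy of a state of rank at most `k` is at most `log k`. -/
theorem reTrace_negMulLog_le_log_of_rank_le {A : Matrix ι ι ℂ} (hA : A.PosSemidef)
    (htr : reTrace A = 1) {k : ℕ} (hk : A.rank ≤ k) :
    reTrace (cfc Real.negMulLog A) ≤ Real.log k := by
  have hsum : ∑ i, hA.1.eigenvalues i = 1 := by
    rw [← htr, ← reTrace_cfc hA.1 (fun x => x), cfc_id' ℝ A hA.1.isSelfAdjoint]
  have hcard : (∑ i, if hA.1.eigenvalues i ≠ 0 then (1 : ℝ) else 0) ≤ k := by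
    rw [hA.1.rank_eq_card_non_zero_eigs, Fintype.card_subtype] at hk
    rw [Finset.sum_boole]
    exact_mod_cast hk
  have hk0 : (0 : ℝ) < k := by
    obtain ⟨i, -, hi⟩ := Finset.exists_ne_zero_of_sum_ne_zero (hsum.trans_ne one_ne_zero)
    refine (Finset.sum_pos' (fun j _ => ?_) ⟨i, Finset.mem_univ i, ?_⟩).trans_le hcard
    · split_ifs <;> norm_num
    · simp [hi]
  rw [reTrace_cfc hA.1]
  calc ∑ i, Real.negMulLog (hA.1.eigenvalues i)
      ≤ ∑ i, ((if hA.1.eigenvalues i ≠ 0 then (1 : ℝ) else 0) / k - hA.1.eigenvalues i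
          + hA.1.eigenvalues i * Real.log k) := by
        refine Finset.sum_le_sum fun i _ => ?_
        have ha := hA.eigenvalues_nonneg i
        generalize hA.1.eigenvalues i = a at *
        rcases ha.eq_or_lt with rfl | ha
        · simp
        · have h := Real.log_le_sub_one_of_pos (show 0 < 1 / (a * k) by positivity)
          rw [one_div, Real.log_inv, Real.log_mul ha.ne' hk0.ne'] at h
          have h2 := mul_le_mul_of_nonneg_left h ha.le
          have h3 : a * ((a * k)⁻¹ - 1) = 1 / k - a := by field_simp
          rw [h3] at h2
          rw [if_pos ha.ne', Real.negMulLog]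
          linarith
    _ = (∑ i, if hA.1.eigenvalues i ≠ 0 then (1 : ℝ) else 0) / k - 1 + Real.log k := by
        rw [Finset.sum_add_distrib, Finset.sum_sub_distrib, ← Finset.sum_mul, hsum, one_mul,
          Finset.sum_div]
    _ ≤ Real.log k := by
        have := (div_le_one hk0).mpr hcard
        linarith

/-- A state of a system and a qubit is at most twice its marginal tensored with the identity. The
four conjugates of `ρ` by Pauli matrices of the qubit add up to this bound, and `ρ` is one of
them. -/
theorem le_two_smul_kroneckerOne {ρ : Matrix (R × Fin 2) (R × Fin 2) ℂ} {A : Matrix R R ℂ}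
    (hρ : 0 ≤ ρ) (hmarg : ∀ a b, ∑ c, ρ (a, c) (b, c) = A a b) :
    ρ ≤ (2 : ℝ) • kroneckerOne R (Fin 2) A := by
  let Z : Matrix (R × Fin 2) (R × Fin 2) ℂ := diagonal fun a => if a.2 = 0 then 1 else -1
  let X : R × Fin 2 → R × Fin 2 := fun a => (a.1, 1 - a.2)
  have h1 : (Z * ρ * Zᴴ).PosSemidef := hρ.posSemidef.mul_mul_conjTranspose_same Z
  have h2 := hρ.posSemidef.submatrix X
  have h3 := h1.submatrix X
  have h : (2 : ℝ) • kroneckerOne R (Fin 2) A - ρ =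
      Z * ρ * Zᴴ + ρ.submatrix X X + (Z * ρ * Zᴴ).submatrix X X := by
    ext ⟨a, i⟩ ⟨b, j⟩
    have := hmarg a b
    rw [Fin.sum_univ_two] at this
    simp only [sub_apply, smul_apply, kroneckerOne_apply, ← this, add_apply, submatrix_apply, Z, X,
      diagonal_conjTranspose, mul_diagonal, diagonal_mul]
    fin_cases i <;> fin_cases j <;> simp <;> ring
  rw [le_iff, h]
  exact (h1.add h2).add h3

end Matrix

section Quantum

/-! ### The reduced density matrix of the emitted quanta -/

/-- Splitting off the last of `n + 1` qubits. -/
def snocBits (n : ℕ) : Bits n × Fin 2 ≃ Bits (n + 1) :=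
  (Equiv.prodComm _ _).trans (Fin.snocEquiv fun _ => Fin 2)

theorem snocBits_apply {n : ℕ} (r : Bits n) (c : Fin 2) :
    snocBits n (r, c) = Fin.snoc (α := fun _ => Fin 2) r c := rfl

theorem sum_bits_succ {n : ℕ} {M : Type*} [AddCommMonoid M] (f : Bits (n + 1) → M) :
    ∑ r, f r = ∑ r : Bits n, ∑ c : Fin 2, f (Fin.snoc (α := fun _ => Fin 2) r c) := by
  rw [← (snocBits n).sum_comp, Fintype.sum_prod_type]
  rfl

theorem norm_add_sq_le_weighted {E : Type*} [SeminormedAddCommGroup E] (x y : E) {t : ℝ}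
    (ht : 0 < t) :
    ‖x + y‖ ^ 2 ≤ (1 + t) * ‖x‖ ^ 2 + (1 + t⁻¹) * ‖y‖ ^ 2 := by
  have h1 : ‖x + y‖ ^ 2 ≤ (‖x‖ + ‖y‖) ^ 2 := by gcongr; exact norm_add_le x y
  have h2 : 0 ≤ t⁻¹ * (t * ‖x‖ - ‖y‖) ^ 2 := by positivity
  have h3 : t⁻¹ * (t * ‖x‖ - ‖y‖) ^ 2 = t * ‖x‖ ^ 2 - 2 * ‖x‖ * ‖y‖ + t⁻¹ * ‖y‖ ^ 2 := by
    field_simp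
    ring
  nlinarith

variable {H : Type*} [NormedAddCommGroup H] [InnerProductSpace ℂ H]

theorem ofReal_norm_sq (x : H) : ((‖x‖ ^ 2 : ℝ) : ℂ) = ⟪x, x⟫_ℂ := by
  rw [inner_self_eq_norm_sq_to_K]; push_cast; rfl

/-- Expectation values of the reduced density matrix are squared norms, which makes it positive
semidefinite. -/
theorem dotProduct_radiationDensity {n : ℕ} (Ψ : HoleRad H n) (v : Bits n → ℂ) :
    star v ⬝ᵥ radiationDensity Ψ *ᵥ v =
      ((∑ l, ‖∑ a, star (v a) • Ψ (l, a)‖ ^ 2 : ℝ) : ℂ) := by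
  rw [Complex.ofReal_sum]
  simp only [ofReal_norm_sq, sum_inner, inner_sum, inner_smul_left,
    inner_smul_right, dotProduct, mulVec, radiationDensity, of_apply, Finset.mul_sum,
    Finset.sum_mul, Pi.star_apply]
  conv_rhs => rw [Finset.sum_comm]; enter [2, x]; rw [Finset.sum_comm]
  refine Finset.sum_congr rfl fun a _ => Finset.sum_congr rfl fun b _ =>
    Finset.sum_congr rfl fun l _ => ?_
  simp only [starRingEnd_apply, star_star]
  ring

theorem radiationDensity_posSemidef {n : ℕ} (Ψ : HoleRad H n) :
    (radiationDensity Ψ).PosSemidef := by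
  refine .of_dotProduct_mulVec_nonneg (radiationDensity_isHermitian Ψ) fun v => ?_
  rw [dotProduct_radiationDensity]
  exact Complex.zero_le_real.mpr (Finset.sum_nonneg fun _ _ => by positivity)

theorem reTrace_radiationDensity {n : ℕ} (Ψ : HoleRad H n) :
    reTrace (radiationDensity Ψ) = ‖Ψ‖ ^ 2 := by
  rw [reTrace_apply, PiLp.norm_sq_eq_of_L2, Fintype.sum_prod_type_right]
  simp only [trace, diag_apply, radiationDensity, of_apply, Complex.re_sum, ← ofReal_norm_sq,
    Complex.ofReal_re]

theorem radiationDensity_smul {n : ℕ} (c : ℂ) (Ψ : HoleRad H n) :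
    radiationDensity (c • Ψ) = (‖c‖ ^ 2 : ℝ) • radiationDensity Ψ := by
  ext a b
  simp only [radiationDensity, of_apply, Matrix.smul_apply, PiLp.smul_apply, inner_smul_left,
    inner_smul_right, Finset.smul_sum, ← mul_assoc, Complex.mul_conj']
  simp

theorem radiationEntropy_eq {n : ℕ} (Ψ : HoleRad H n) :
    radiationEntropy Ψ = reTrace (cfc Real.negMulLog (radiationDensity Ψ)) :=
  (reTrace_cfc (radiationDensity_isHermitian Ψ) _).symm

open scoped MatrixOrder in
/-- If a state is the sum of `Ψ` and a correction `Δ`, its reduced density matrix is the one of `Ψ`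
up to a relative error `t` and an additive one quadratic in `Δ`. -/
theorem radiationDensity_add_le {n : ℕ} (Ψ Δ : HoleRad H n) {t : ℝ} (ht : 0 < t) :
    radiationDensity (Ψ + Δ) ≤
      (1 + t) • radiationDensity Ψ + (1 + t⁻¹) • radiationDensity Δ := by
  rw [le_iff]
  refine .of_dotProduct_mulVec_nonneg ?_ fun v => ?_
  · refine ((IsSelfAdjoint.smul (IsSelfAdjoint.all _)
      (radiationDensity_isHermitian Ψ).isSelfAdjoint).add
      (IsSelfAdjoint.smul (IsSelfAdjoint.all _)
      (radiationDensity_isHermitian Δ).isSelfAdjoint)).sub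
      (radiationDensity_isHermitian (Ψ + Δ)).isSelfAdjoint
  · rw [sub_mulVec, add_mulVec, smul_mulVec, smul_mulVec, dotProduct_sub, dotProduct_add,
      dotProduct_smul, dotProduct_smul, dotProduct_radiationDensity, dotProduct_radiationDensity,
      dotProduct_radiationDensity, Complex.real_smul, Complex.real_smul, ← Complex.ofReal_mul,
      ← Complex.ofReal_mul, ← Complex.ofReal_add, ← Complex.ofReal_sub, Complex.zero_le_real,
      sub_nonneg, Finset.mul_sum, Finset.mul_sum, ← Finset.sum_add_distrib]
    refine Finset.sum_le_sum fun l _ => ?_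
    simp only [PiLp.add_apply, smul_add, Finset.sum_add_distrib]
    exact norm_add_sq_le_weighted _ _ ht

/-! ### Bell pairs -/

theorem one_div_sqrt_two_mul_self :
    ((1 / √2 : ℝ) : ℂ) * ((1 / √2 : ℝ) : ℂ) = ((1 / 2 : ℝ) : ℂ) := by
  rw [← Complex.ofReal_mul]
  congr 1
  rw [div_mul_div_comm, Real.mul_self_sqrt (by norm_num)]
  norm_num

theorem tensorBell_snoc {n : ℕ} (Λ : HoleRad H n) (l r : Bits n) (b c : Fin 2) :
    tensorBell Λ (Fin.snoc (α := fun _ => Fin 2) l b, Fin.snoc (α := fun _ => Fin 2) r c) =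
      if b = c then ((1 / √2 : ℝ) : ℂ) • Λ (l, r) else 0 := by
  simp [tensorBell]

theorem bellComponent_apply {n : ℕ} (Ψ : HoleRad H (n + 1)) (l r : Bits n) :
    bellComponent Ψ (l, r) = ((1 / √2 : ℝ) : ℂ) • ∑ b : Fin 2,
      Ψ (Fin.snoc (α := fun _ => Fin 2) l b, Fin.snoc (α := fun _ => Fin 2) r b) := rfl

theorem bellComponent_tensorBell {n : ℕ} (Λ : HoleRad H n) :
    bellComponent (tensorBell Λ) = Λ := by
  ext ⟨l, r⟩
  rw [bellComponent_apply]
  simp only [tensorBell_snoc, if_true, Finset.sum_const, Finset.card_univ, Fintype.card_fin]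
  rw [← Nat.cast_smul_eq_nsmul ℂ, smul_smul, smul_smul, mul_right_comm, one_div_sqrt_two_mul_self]
  norm_num

/-- `bellComponent` is the adjoint of `tensorBell`. -/
theorem inner_tensorBell {n : ℕ} (Λ : HoleRad H n) (Ψ : HoleRad H (n + 1)) :
    ⟪tensorBell Λ, Ψ⟫_ℂ = ⟪Λ, bellComponent Ψ⟫_ℂ := by
  simp only [PiLp.inner_apply, Fintype.sum_prod_type, sum_bits_succ, tensorBell_snoc,
    bellComponent_apply]
  refine Finset.sum_congr rfl fun l _ => ?_
  rw [Finset.sum_comm]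
  refine Finset.sum_congr rfl fun r _ => ?_
  rw [inner_smul_right, inner_sum, Finset.mul_sum]
  refine Finset.sum_congr rfl fun b _ => ?_
  rw [Finset.sum_eq_single b]
  · rw [if_pos rfl, inner_smul_left, Complex.conj_ofReal]
  · intro c _ hc
    rw [if_neg hc.symm, inner_zero_left]
  · simp

theorem tensorBell_sub {n : ℕ} (Λ Λ' : HoleRad H n) :
    tensorBell (Λ - Λ') = tensorBell Λ - tensorBell Λ' := by
  ext q
  simp only [tensorBell, PiLp.sub_apply]
  split_ifs <;> simp [smul_sub]

theorem tensorBell_smul {n : ℕ} (z : ℂ) (Λ : HoleRad H n) :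
    tensorBell (z • Λ) = z • tensorBell Λ := by
  ext q
  simp only [tensorBell, PiLp.smul_apply]
  split_ifs
  · rw [smul_comm]
  · rw [smul_zero]

theorem bellComponent_sub {n : ℕ} (Ψ Ψ' : HoleRad H (n + 1)) :
    bellComponent (Ψ - Ψ') = bellComponent Ψ - bellComponent Ψ' := by
  ext ⟨l, r⟩
  simp only [bellComponent_apply, PiLp.sub_apply, Finset.sum_sub_distrib, smul_sub]

/-- `Ψ ↦ tensorBell (bellComponent Ψ)` is the orthogonal projection, hence the best
approximation. -/
theorem pairCorrection_le {n : ℕ} (Ψ : HoleRad H (n + 1)) (Λ : HoleRad H n) :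
    pairCorrection Ψ ≤ ‖Ψ - tensorBell Λ‖ := by
  have h : ⟪tensorBell (bellComponent Ψ - Λ), Ψ - tensorBell (bellComponent Ψ)⟫_ℂ = 0 := by
    rw [inner_tensorBell, bellComponent_sub, bellComponent_tensorBell, sub_self, inner_zero_right]
  have h2 : Ψ - tensorBell Λ =
      tensorBell (bellComponent Ψ - Λ) + (Ψ - tensorBell (bellComponent Ψ)) := by
    rw [tensorBell_sub]; abel
  have h3 := norm_add_sq_eq_norm_sq_add_norm_sq_of_inner_eq_zero _ _ h
  rw [← h2] at h3
  rw [pairCorrection]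
  nlinarith [norm_nonneg (Ψ - tensorBell Λ), norm_nonneg (Ψ - tensorBell (bellComponent Ψ)),
    norm_nonneg (tensorBell (bellComponent Ψ - Λ))]

/-- After the emission of a Bell pair, the new quantum is maximally mixed and independent of the
earlier ones. -/
theorem radiationDensity_tensorBell {n : ℕ} (Λ : HoleRad H n) :
    (radiationDensity (tensorBell Λ)).submatrix (snocBits n) (snocBits n) =
      kroneckerOne (Bits n) (Fin 2) ((1 / 2 : ℝ) • radiationDensity Λ) := by
  ext ⟨a, i⟩ ⟨b, j⟩
  simp only [submatrix_apply, snocBits_apply, radiationDensity, of_apply, sum_bits_succ,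
    tensorBell_snoc, kroneckerOne_apply, Matrix.smul_apply]
  by_cases hij : i = j
  · subst hij
    rw [if_pos rfl, Finset.smul_sum]
    refine Finset.sum_congr rfl fun l _ => ?_
    rw [Finset.sum_eq_single i]
    · rw [if_pos rfl, if_pos rfl, inner_smul_left, inner_smul_right, Complex.conj_ofReal,
        ← mul_assoc, one_div_sqrt_two_mul_self, Complex.real_smul]
    · intro c _ hc
      rw [if_neg hc, inner_zero_left]
    · simp
  · rw [if_neg hij]
    refine Finset.sum_eq_zero fun l _ => Finset.sum_eq_zero fun c _ => ?_
    by_cases hc : c = j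
    · rw [if_neg fun h : c = i => hij (h.symm.trans hc), inner_zero_right]
    · rw [if_neg hc, inner_zero_left]

/-! ### One step of the evolution -/

theorem inner_withMode {n : ℕ} (Ψ Ψ' : HoleRad H n) (φ : Fock) :
    ⟪withMode Ψ φ, withMode Ψ' φ⟫_ℂ = ((‖φ‖ ^ 2 : ℝ) : ℂ) * ⟪Ψ, Ψ'⟫_ℂ := by
  have h := lp.hasSum_inner (𝕜 := ℂ) (withMode Ψ φ) (withMode Ψ' φ)
  have h2 := (lp.hasSum_inner (𝕜 := ℂ) φ φ).mul_right ⟪Ψ, Ψ'⟫_ℂ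
  rw [← ofReal_norm_sq] at h2
  have h3 : (fun k => ⟪withMode Ψ φ k, withMode Ψ' φ k⟫_ℂ) =
      fun k => ⟪φ k, φ k⟫_ℂ * ⟪Ψ, Ψ'⟫_ℂ := by
    funext k
    change ⟪φ k • Ψ, φ k • Ψ'⟫_ℂ = _
    rw [inner_smul_left, inner_smul_right, ← mul_assoc, RCLike.inner_apply, mul_comm (φ k)]
  rw [h3] at h
  exact h.unique h2

theorem norm_withMode {n : ℕ} (Ψ : HoleRad H n) (φ : Fock) :
    ‖withMode Ψ φ‖ = ‖φ‖ * ‖Ψ‖ := by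
  have h := inner_withMode Ψ Ψ φ
  rw [← ofReal_norm_sq, ← ofReal_norm_sq, ← Complex.ofReal_mul, Complex.ofReal_inj,
    ← mul_pow] at h
  exact (pow_left_inj₀ (norm_nonneg _) (by positivity) two_ne_zero).mp h

/-- Local evolution acts in the same way on the components of the state at all values `r` of the
quanta emitted before: the part of the result at `r` depends on `Ψ (·, r)` only. -/
theorem IsLocal.apply_withMode_eq {n : ℕ} {W : WithMode H n →ₗᵢ[ℂ] HoleRad H (n + 1)}
    (hW : IsLocal W) (φ : Fock) {Ψ Ψ' : HoleRad H n} {r r' : Bits n}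
    (h : ∀ l, Ψ (l, r) = Ψ' (l, r')) (l : Bits n) (b c : Fin 2) :
    W (withMode Ψ φ)
        (Fin.snoc (α := fun _ => Fin 2) l b, Fin.snoc (α := fun _ => Fin 2) r c) =
      W (withMode Ψ' φ)
        (Fin.snoc (α := fun _ => Fin 2) l b, Fin.snoc (α := fun _ => Fin 2) r' c) := by
  obtain ⟨V, hV⟩ := hW
  have key : ∀ (Ψ : HoleRad H n) (r : Bits n), HasSum
      (fun k => φ k • V k (WithLp.toLp 2 fun l' => Ψ (l', r)) b c l) (W (withMode Ψ φ)
        (Fin.snoc (α := fun _ => Fin 2) l b, Fin.snoc (α := fun _ => Fin 2) r c)) := by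
    intro Ψ r
    have h1 := (lp.hasSum_single (p := 2) (by simp) (withMode Ψ φ)).mapL
      ((PiLp.proj 2 (fun _ : Bits (n + 1) × Bits (n + 1) => H)
        (Fin.snoc (α := fun _ => Fin 2) l b, Fin.snoc (α := fun _ => Fin 2) r c) :
          HoleRad H (n + 1) →L[ℂ] H).comp W.toContinuousLinearMap)
    simpa [hV, withMode] using h1
  have h1 := key Ψ r
  simp only [h] at h1
  exact h1.unique (key Ψ' r')

/-- Local evolution does not change the reduced state of the quanta emitted before: it acts as an
isometry on each of their components separately. -/
theorem IsLocal.marginal {n : ℕ} {W : WithMode H n →ₗᵢ[ℂ] HoleRad H (n + 1)}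
    (hW : IsLocal W) {φ : Fock} (hφ : ‖φ‖ = 1) (Ψ : HoleRad H n) (a b : Bits n) :
    ∑ c : Fin 2, radiationDensity (W (withMode Ψ φ)) (Fin.snoc (α := fun _ => Fin 2) a c)
      (Fin.snoc (α := fun _ => Fin 2) b c) = radiationDensity Ψ a b := by
  -- the components of `Ψ` at `a` and at `b`, both moved to `a`
  let X : Bits n → HoleRad H n := fun r =>
    WithLp.toLp 2 fun q => if q.2 = a then Ψ (q.1, r) else 0
  have hX : ∀ r, ∀ l b' c, W (withMode (X r) φ)
      (Fin.snoc (α := fun _ => Fin 2) l b', Fin.snoc (α := fun _ => Fin 2) a c) =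
      W (withMode Ψ φ)
      (Fin.snoc (α := fun _ => Fin 2) l b', Fin.snoc (α := fun _ => Fin 2) r c) := by
    intro r l b' c
    exact hW.apply_withMode_eq φ (fun l => by simp [X]) l b' c
  have hX0 : ∀ r r', r' ≠ a → ∀ l b' c, W (withMode (X r) φ)
      (Fin.snoc (α := fun _ => Fin 2) l b', Fin.snoc (α := fun _ => Fin 2) r' c) = 0 := by
    intro r r' hr' l b' c
    have h0 : withMode (0 : HoleRad H n) φ = 0 := by
      ext k : 2
      simp [withMode]
    rw [hW.apply_withMode_eq (Ψ' := 0) (r' := r') φ (fun l => by simp [X, hr']) l b' c, h0,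
      map_zero]
    rfl
  have h1 : ⟪W (withMode (X b) φ), W (withMode (X a) φ)⟫_ℂ = radiationDensity Ψ a b := by
    rw [W.inner_map_map, inner_withMode, hφ]
    simp only [PiLp.inner_apply, Fintype.sum_prod_type, X, radiationDensity, of_apply, one_pow,
      Complex.ofReal_one, one_mul]
    refine Finset.sum_congr rfl fun l _ => ?_
    rw [Finset.sum_eq_single a]
    · simp
    · intro r _ hr
      rw [if_neg hr, inner_zero_left]
    · simp
  rw [← h1, PiLp.inner_apply, Fintype.sum_prod_type, sum_bits_succ]
  simp only [sum_bits_succ (n := n), radiationDensity, of_apply]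
  rw [Finset.sum_comm]
  refine Finset.sum_congr rfl fun l _ => ?_
  rw [Finset.sum_comm]
  refine Finset.sum_congr rfl fun b' _ => ?_
  rw [Finset.sum_eq_single a]
  · simp only [hX]
  · intro r hr hra
    simp [hX0 _ _ hra]
  · simp

/-- A mode with few particles is close to a multiple of the vacuum, on which the evolution is
semiclassical. -/
theorem norm_evolution_sub_lt {n : ℕ} {W : WithMode H n →ₗᵢ[ℂ] HoleRad H (n + 1)} {δ γ : ℝ}
    (hW : IsSemiclassical δ W) {φ : Fock} (hφ : ‖φ‖ = 1)
    (hφγ : particleWeight φ < γ) {Ψ : HoleRad H n} (hΨ : ‖Ψ‖ = 1) :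
    ‖W (withMode Ψ φ) - φ 0 • tensorBell Ψ‖ < δ + √γ := by
  set χ : Fock := φ - φ 0 • vacuum with hχ
  have hφ0 : ‖φ 0‖ ≤ 1 := hφ ▸ lp.norm_apply_le_norm (by norm_num) φ 0
  have hχk : ∀ k, χ k = φ k - φ 0 * vacuum k := fun k => rfl
  have hχ0 : χ 0 = 0 := by rw [hχk, vacuum, lp.single_apply_self, mul_one, sub_self]
  have hχs : ∀ k, χ (k + 1) = φ (k + 1) := by
    intro k
    rw [hχk, vacuum, lp.single_apply_ne _ _ _ k.succ_ne_zero, mul_zero, sub_zero]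
  have hχn : ‖χ‖ ^ 2 = particleWeight φ := by
    have h := lp.hasSum_norm (p := 2) (by norm_num) χ
    have h' : HasSum (fun k => ‖χ k‖ ^ 2) (‖χ‖ ^ 2) := by simpa using h
    rw [← h'.tsum_eq, h'.summable.tsum_eq_zero_add, hχ0]
    simp [particleWeight, hχs]
  have hχγ : ‖χ‖ < √γ := Real.lt_sqrt_of_sq_lt (hχn ▸ hφγ)
  have hdec : withMode Ψ φ = φ 0 • withMode Ψ vacuum + withMode Ψ χ := by
    ext k : 2
    change φ k • Ψ = φ 0 • vacuum k • Ψ + χ k • Ψ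
    rw [hχk, smul_smul, ← add_smul, add_sub_cancel]
  have h1 : W (withMode Ψ φ) - φ 0 • tensorBell Ψ =
      φ 0 • (W (withMode Ψ vacuum) - tensorBell Ψ) + W (withMode Ψ χ) := by
    rw [hdec, map_add, map_smul, smul_sub]; abel
  rw [h1]
  refine (norm_add_le _ _).trans_lt ?_
  rw [norm_smul, W.norm_map, norm_withMode, hΨ, mul_one]
  have h2 := hW Ψ
  rw [hΨ, mul_one] at h2
  have : ‖φ 0‖ * ‖W (withMode Ψ vacuum) - tensorBell Ψ‖ ≤ 1 * δ :=
    mul_le_mul hφ0 h2 (norm_nonneg _) zero_le_one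
  linarith

/-! ### Entropy balance of one step -/

open scoped MatrixOrder in
/-- A local step whose result is within `μ` of the Bell pair state raises the entropy by `log 2`, up
to an error that does not depend on the number of quanta emitted before. -/
theorem radiationEntropy_evolution_ge {n : ℕ} {W : WithMode H n →ₗᵢ[ℂ] HoleRad H (n + 1)}
    (hloc : IsLocal W) {φ : Fock} (hφ : ‖φ‖ = 1) {Ψ : HoleRad H n} (hΨ : ‖Ψ‖ = 1) {μ s : ℝ}
    (hμ : 0 < μ) (hμ1 : μ ≤ 1) (hd : ‖W (withMode Ψ φ) - φ 0 • tensorBell Ψ‖ ≤ μ)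
    (hs : 3 / 4 ≤ s) (hs1 : s < 1) :
    radiationEntropy Ψ + Real.log 2 - 6 * Real.log (1 - s)⁻¹ * μ - Real.log s⁻¹ ≤
      radiationEntropy (W (withMode Ψ φ)) := by
  set Ψ' := W (withMode Ψ φ) with hΨ'
  set Δ := Ψ' - φ 0 • tensorBell Ψ with hΔ
  have hφ0 : ‖φ 0‖ ≤ 1 := hφ ▸ lp.norm_apply_le_norm (by norm_num) φ 0
  have hA : 0 ≤ radiationDensity Ψ := (radiationDensity_posSemidef Ψ).nonneg
  have htr : reTrace (radiationDensity Ψ) = 1 := by rw [reTrace_radiationDensity, hΨ, one_pow]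
  set σ := kroneckerOne (Bits n) (Fin 2) ((1 / 2 : ℝ) • radiationDensity Ψ) with hσdef
  have hσ : 0 ≤ σ := kroneckerOne_nonneg (smul_nonneg (by norm_num) hA)
  set ρ := (radiationDensity Ψ').submatrix (snocBits n) (snocBits n) with hρdef
  have hρ : 0 ≤ ρ := ((radiationDensity_posSemidef Ψ').submatrix _).nonneg
  -- the weight `t = μ` balances the relative error `t` against the additive error `(1 + 1/t) μ²`
  set E := (1 + μ⁻¹) • (radiationDensity Δ).submatrix (snocBits n) (snocBits n) with hEdef
  have hE : 0 ≤ E :=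
    smul_nonneg (by positivity) ((radiationDensity_posSemidef Δ).submatrix _).nonneg
  have hmarg : ∀ a b, ∑ c, ρ (a, c) (b, c) = radiationDensity Ψ a b :=
    fun a b => hloc.marginal hφ Ψ a b
  have h4 : ρ ≤ (4 : ℝ) • σ := by
    refine (le_two_smul_kroneckerOne hρ hmarg).trans_eq ?_
    rw [hσdef, map_smul, smul_smul]
    norm_num
  have htrE : reTrace E ≤ 2 * μ := by
    have h1 : reTrace ((radiationDensity Δ).submatrix (snocBits n) (snocBits n)) = ‖Δ‖ ^ 2 := by
      rw [← reTrace_radiationDensity, reTrace_apply, reTrace_apply]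
      congr 1
      exact Equiv.sum_comp (snocBits n) fun i => radiationDensity Δ i i
    rw [hEdef, map_smul, h1, smul_eq_mul]
    have h2 : ‖Δ‖ ^ 2 ≤ μ ^ 2 := by gcongr
    have h3 : (1 + μ⁻¹) * μ ^ 2 = μ ^ 2 + μ := by field_simp
    calc (1 + μ⁻¹) * ‖Δ‖ ^ 2 ≤ (1 + μ⁻¹) * μ ^ 2 := by gcongr
      _ ≤ 2 * μ := by rw [h3]; nlinarith
  have hρE : ρ ≤ (1 + μ) • σ + E := by
    have h1 := radiationDensity_add_le (φ 0 • tensorBell Ψ) Δ hμ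
    rw [hΔ, add_sub_cancel, ← hΔ] at h1
    have h2 : ρ ≤ (1 + μ) • (‖φ 0‖ ^ 2 : ℝ) • σ + E := by
      have h3 := (le_iff.mp h1).submatrix (snocBits n)
      rw [radiationDensity_smul] at h3
      rw [hσdef, ← radiationDensity_tensorBell]
      exact h3
    refine h2.trans (add_le_add (smul_le_smul_real ?_ (by positivity)) le_rfl)
    calc (‖φ 0‖ ^ 2 : ℝ) • σ ≤ (1 : ℝ) • σ :=
          smul_le_smul_of_nonneg_right (pow_le_one₀ (norm_nonneg _) hφ0) hσ
      _ = σ := one_smul _ _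
  have h := entropy_add_log_two_le hρ hA htr hmarg h4 hE htrE hμ.le hρE hs hs1
  rw [reTrace_cfc_submatrix (radiationDensity_isHermitian Ψ'), ← radiationEntropy_eq,
    ← radiationEntropy_eq] at h
  linarith

/-- A pure state on remnant and radiation has a reduced state of rank at most the dimension of the
remnant, which bounds the entropy of the radiation. -/
theorem leadsToMixedStateOrRemnant_of_entropy {N : ℕ} {Ψ : HoleRad H N} (hΨ : ‖Ψ‖ = 1)
    (h : (N : ℝ) / 2 * Real.log 2 < radiationEntropy Ψ) :
    LeadsToMixedStateOrRemnant (radiationDensity Ψ) := by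
  intro κ _ σ _ hmarg
  rw [or_iff_not_imp_left, not_not]
  rintro ⟨χ, rfl⟩
  let M : Matrix (Bits N) κ ℂ := Matrix.of fun a m => χ (m, a)
  have hM : radiationDensity Ψ = M * Mᴴ := by
    ext a b
    rw [← hmarg a b, mul_apply]
    rfl
  have hrank : (radiationDensity Ψ).rank ≤ Fintype.card κ := by
    rw [hM]
    exact (rank_mul_le_left _ _).trans (rank_le_card_width _)
  have h1 := reTrace_negMulLog_le_log_of_rank_le (radiationDensity_posSemidef Ψ)
    (by rw [reTrace_radiationDensity, hΨ, one_pow]) hrank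
  rw [← radiationEntropy_eq] at h1
  have h2 := h.trans_le h1
  by_contra! hcard
  -- the empty basis is excluded separately, because of the convention `log 0 = 0`
  rcases Nat.eq_zero_or_pos (Fintype.card κ) with h0 | h0
  · rw [h0, Nat.cast_zero, Real.log_zero] at h2
    have : 0 ≤ (N : ℝ) / 2 * Real.log 2 := by positivity
    linarith
  · have h3 := Real.log_le_log (by exact_mod_cast h0) hcard
    rw [Real.log_rpow two_pos] at h3
    linarith

theorem radiationEntropy_nonneg {n : ℕ} {Ψ : HoleRad H n} (hΨ : ‖Ψ‖ = 1) :
    0 ≤ radiationEntropy Ψ := by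
  have hpos := radiationDensity_posSemidef Ψ
  have hsum : ∑ i, hpos.1.eigenvalues i = 1 := by
    rw [← reTrace_cfc hpos.1 (fun x => x), cfc_id' ℝ _ hpos.1.isSelfAdjoint,
      reTrace_radiationDensity, hΨ, one_pow]
  refine Finset.sum_nonneg fun i _ => Real.negMulLog_nonneg (hpos.eigenvalues_nonneg i) ?_
  rw [← hsum]
  exact Finset.single_le_sum (fun j _ => hpos.eigenvalues_nonneg j) (Finset.mem_univ i)

end Quantum

/-! ### The whole evaporation -/

theorem Evaporation.norm_state {H : Type*} [NormedAddCommGroup H] [InnerProductSpace ℂ H]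
    (P : Evaporation H) : ∀ n, ‖P.state n‖ = 1
  | 0 => by
    have h : ‖P.state 0‖ ^ 2 = 1 := by
      simp [PiLp.norm_sq_eq_of_L2, Evaporation.state, P.matter_norm]
    exact (pow_eq_one_iff_of_nonneg (norm_nonneg _) two_ne_zero).mp h
  | n + 1 => by
    rw [Evaporation.state, LinearIsometry.norm_map, norm_withMode, P.mode_norm, P.norm_state n,
      one_mul]

theorem mainTheorem2 {H : Type*} [NormedAddCommGroup H] [InnerProductSpace ℂ H]
    (ε : ℝ) (hε : 0 < ε) (hε' : ε ≤ Real.log 2 / 4) :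
    ∃ γ > 0, ∀ C : Set (Evaporation H), NicenessEnsuresLocalEvolution C →
      ∃ η > 0, ∀ P ∈ C, P.Nice η → P.IsTraditional η γ →
        (∀ n < P.N, pairCorrection (P.state (n + 1)) < ε) ∧
        (∀ n < P.N, radiationEntropy (P.state n) + Real.log 2 - 2 * ε <
          radiationEntropy (P.state (n + 1))) ∧
        (0 < P.N → (P.N : ℝ) / 2 * Real.log 2 < radiationEntropy (P.state P.N) ∧
          LeadsToMixedStateOrRemnant (radiationDensity (P.state P.N))) := by
  -- the mixing weight `s` is chosen such that `log (1 / s) = ε`, one half of the permitted loss of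
  -- entropy; the remaining loss `6 c μ` is made smaller than `ε` by the choice of `μ`
  set s := Real.exp (-ε) with hsdef
  have hs1 : s < 1 := by simpa [hsdef] using hε
  have hs : 3 / 4 ≤ s := by
    have := Real.add_one_le_exp (-ε)
    have := Real.log_two_lt_d9
    linarith
  have hlogs : Real.log s⁻¹ = ε := by rw [Real.log_inv, hsdef, Real.log_exp, neg_neg]
  set c := Real.log (1 - s)⁻¹ with hc
  have hc0 : 0 < c := Real.log_pos ((one_lt_inv₀ (by linarith)).mpr (by linarith))
  set μ := min ε (ε / (12 * c)) with hμdef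
  have hμ : 0 < μ := lt_min hε (by positivity)
  have hμε : μ ≤ ε := min_le_left _ _
  have hμ1 : μ ≤ 1 := by
    have := Real.log_two_lt_d9
    linarith
  have hμc : 6 * c * μ ≤ ε / 2 := by
    calc 6 * c * μ ≤ 6 * c * (ε / (12 * c)) := by gcongr; exact min_le_right _ _
      _ = ε / 2 := by field_simp; norm_num
  -- particles in the mode and deviations from semiclassical evolution contribute `μ / 2` each
  refine ⟨(μ / 2) ^ 2, by positivity, fun C hC => ?_⟩
  obtain ⟨η, hη, h⟩ := hC (μ / 2) (by positivity)
  refine ⟨η, hη, fun P hP hnice htrad => ?_⟩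
  have hstep : ∀ n < P.N, IsLocal (P.evolution n) ∧
      ‖P.state (n + 1) - P.mode n 0 • tensorBell (P.state n)‖ < μ := by
    intro n hn
    obtain ⟨hloc, hsemi⟩ := h P hP n hn (hnice n hn) (htrad n hn).1
    obtain ⟨x, hx, hx0⟩ := P.support_horizon n hn
    have hfree := (htrad n hn).2 x hx0 hx (hnice n hn).2
    refine ⟨hloc, ?_⟩
    have := norm_evolution_sub_lt hsemi (P.mode_norm n) hfree (P.norm_state n)
    rwa [Real.sqrt_sq (by positivity), add_halves] at this
  have hent : ∀ n < P.N, radiationEntropy (P.state n) + Real.log 2 - 2 * ε <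
      radiationEntropy (P.state (n + 1)) := by
    intro n hn
    obtain ⟨hloc, hd⟩ := hstep n hn
    have := radiationEntropy_evolution_ge hloc (P.mode_norm n) (P.norm_state n) hμ hμ1 hd.le hs hs1
    rw [hlogs, ← hc] at this
    refine lt_of_lt_of_le ?_ this
    linarith
  -- only a weak inequality, as it includes `n = 0`; the last step supplies the strict one
  have hgrow : ∀ n ≤ P.N, n * (Real.log 2 - 2 * ε) ≤ radiationEntropy (P.state n) := by
    intro n
    induction n with
    | zero => intro _; simpa using radiationEntropy_nonneg (P.norm_state 0)
    | succ n ih =>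
      intro hn
      have h1 := ih (by omega)
      have h2 := hent n (by omega)
      push_cast
      linarith
  refine ⟨fun n hn => ?_, hent, fun hN => ?_⟩
  · have h1 := pairCorrection_le (P.state (n + 1)) (P.mode n 0 • P.state n)
    rw [tensorBell_smul] at h1
    exact (h1.trans_lt (hstep n hn).2).trans_le hμε
  · have key : (P.N : ℝ) / 2 * Real.log 2 < radiationEntropy (P.state P.N) := by
      obtain ⟨n, hn⟩ : ∃ n, P.N = n + 1 := ⟨P.N - 1, by omega⟩
      have h1 := hgrow n (by omega)
      have h2 := hent n (by omega)
      rw [hn]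
      push_cast
      have : (n : ℝ) * (Real.log 2 / 2) ≤ n * (Real.log 2 - 2 * ε) := by gcongr; linarith
      linarith
    exact ⟨key, leadsToMixedStateOrRemnant_of_entropy (P.norm_state P.N) key⟩
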